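/- Let $\mathcal M'_1=(\mathcal N',\mathcal I'_1)$ and $\mathcal M'_2=(\mathcal N',\mathcal I'_2)$ be two matroids on the same finite ground set $\mathcal N'$, and let $w(e)$ be a positive integer weight for each $e\in\mathcal N'$. Let $\mathcal N=\{e_i : e\in\mathcal N',\ 1\le i\le w(e)\}$ consist of $w(e)$ copies $e_1,\dots,e_{w(e)}$ of each element $e$. The unfolded matroids $\mathcal M_1=(\mathcal N,\mathcal I_1)$ and $\mathcal M_2=(\mathcal N,\mathcal I_2)$ are defined as follows: a set $I\subseteq\mathcal N$ is in $\mathcal I_1$ if and only if $\{e : e_i\in I\}\in\mathcal I'_1$ for all $i\ge 1$, and it is in $\mathcal I_2$ if and only if $\{e : w(e)-i+1\ge 1 \text{ and } e_{w(e)-i+1}\in I\}\in\mathcal I'_2$ for all $i\ge 1$. Let $\alpha\in\mathbb R$ and let $S\subseteq\mathcal N$ be an $\alpha$-approximate maximum cardinality common independent set of $\mathcal M_1,\mathcal M_2$, that is, $S\in\mathcal I_1\cap\mathcal I_2$ and $|S|\ge\alpha\cdot\max\{|I| : I\in\mathcal I_1\cap\mathcal I_2\}$. Let $\mathcal N'_S=\{e\in\mathcal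 N' : e_j\in S\text{ for some } 1\le j\le w(e)\}$. Let $\mathrm{opt}'$ be the maximum weight $w(I)=\sum_{e\in I}w(e)$ of a common independent set $I$ of $\mathcal M'_1,\mathcal M'_2$, and let $\mathrm{opt}'_S$ be the maximum weight of a common independent set of the restrictions $\mathcal M'_1|\mathcal N'_S,\ \mathcal M'_2|\mathcal N'_S$. Then $\mathrm{opt}'_S\ge\alpha\cdot\mathrm{opt}'$. -/

import Mathlib

/-!
Matroids are Mathlib matroids; finiteness of the ground set is the class `Matroid.Finite`.
The copy `e_i` of an element `e` (with `1 ≤ i ≤ w e`) is the pair `(e, i)`.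
-/

namespace MatroidUnfold

variable {β : Type*}

/-- The ground set of the unfolded matroids: `w e` copies `(e, 1), …, (e, w e)` of each `e ∈ E`. -/
def copies (E : Set β) (w : β → ℕ) : Set (β × ℕ) :=
  {p | p.1 ∈ E ∧ 1 ≤ p.2 ∧ p.2 ≤ w p.1}

/-- The `i`-th layer of `I` for the first matroid: `{e | e_i ∈ I}`. -/
def layer₁ (I : Set (β × ℕ)) (i : ℕ) : Set β := {e | (e, i) ∈ I}

/-- The `i`-th layer of `I` for the second matroid: `{e | e_{w(e)-i+1} ∈ I}`. The index is to be a
number `≥ 1`; for `i > w e` the truncated difference `w e + 1 - i` is `0`, which is never the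
index of a copy. -/
def layer₂ (w : β → ℕ) (I : Set (β × ℕ)) (i : ℕ) : Set β := {e | (e, w e + 1 - i) ∈ I}

/-- A matroid whose independent sets are given by the first layers. -/
theorem exists_unfold₁ (M : Matroid β) (w : β → ℕ) :
    ∃ N : Matroid (β × ℕ), copies M.E w = N.E ∧
      ∀ I, N.Indep I ↔ I ⊆ copies M.E w ∧ ∀ i, M.Indep (layer₁ I i) := by
  refine ⟨((Matroid.sum' (fun _ : ℕ ↦ M)).mapEquiv (Equiv.prodComm ℕ β)).restrict (copies M.E w),
    rfl, fun I ↦ ?_⟩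
  rw [Matroid.restrict_indep_iff, Matroid.mapEquiv_indep_iff, Matroid.sum'_indep_iff, and_comm]
  refine and_congr_right fun _ ↦ forall_congr' fun i ↦ ?_
  rw [show Prod.mk i ⁻¹' ((Equiv.prodComm ℕ β).symm '' I) = layer₁ I i by
    ext e; simp [layer₁]]

/-- A matroid whose independent sets are given by the second layers. -/
theorem exists_unfold₂ (M : Matroid β) (w : β → ℕ) :
    ∃ N : Matroid (β × ℕ), copies M.E w = N.E ∧
      ∀ I, N.Indep I ↔ I ⊆ copies M.E w ∧ ∀ i, M.Indep (layer₂ w I i) := by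
  obtain ⟨N, hE, hN⟩ := exists_unfold₁ M w
  have hinj : Set.InjOn (fun p : β × ℕ ↦ (p.1, w p.1 + 1 - p.2)) (copies M.E w) := by
    rintro ⟨e, i⟩ ⟨_, h1, h2⟩ ⟨f, j⟩ ⟨_, h3, h4⟩ h
    simp only [Prod.mk.injEq] at h h1 h2 h3 h4
    obtain ⟨rfl, h⟩ := h
    simp only [Prod.mk.injEq, true_and]
    omega
  refine ⟨(N.comap (fun p : β × ℕ ↦ (p.1, w p.1 + 1 - p.2))).restrict (copies M.E w), rfl, fun I ↦ ?_⟩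
  rw [Matroid.restrict_indep_iff, Matroid.comap_indep_iff, hN, and_comm]
  refine and_congr_right fun hI ↦ ?_
  have hsub : (fun p : β × ℕ ↦ (p.1, w p.1 + 1 - p.2)) '' I ⊆ copies M.E w := by
    rintro _ ⟨⟨e, i⟩, hp, rfl⟩
    obtain ⟨h0, h1, h2⟩ := hI hp
    refine ⟨h0, ?_, ?_⟩ <;> simp only at h1 h2 ⊢ <;> omega
  have hlay : ∀ i, layer₁ ((fun p : β × ℕ ↦ (p.1, w p.1 + 1 - p.2)) '' I) i = layer₂ w I i := by
    intro i
    ext e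
    constructor
    · rintro ⟨⟨f, j⟩, hp, h⟩
      obtain ⟨h0, h1, h2⟩ := hI hp
      simp only [Prod.mk.injEq] at h h1 h2
      obtain ⟨rfl, h⟩ := h
      change (f, w f + 1 - i) ∈ I
      rwa [show w f + 1 - i = j by omega]
    · intro hp
      obtain ⟨h0, h1, h2⟩ := hI hp
      simp only at h1 h2
      refine ⟨_, hp, ?_⟩
      simp only [Prod.mk.injEq, true_and]
      omega
  simp only [hlay, hsub, hinj.mono hI, true_and, and_true]

/-- The first unfolded matroid: a set of copies is independent iff all its first layers are
independent. (If all weights are at most `W`, all layers outside `1, …, W` are empty.) -/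
def unfold₁ (M : Matroid β) (w : β → ℕ) : Matroid (β × ℕ) :=
  Matroid.ofExistsMatroid (copies M.E w)
    (fun I ↦ I ⊆ copies M.E w ∧ ∀ i, M.Indep (layer₁ I i)) (exists_unfold₁ M w)

/-- The second unfolded matroid: a set of copies is independent iff all its second layers are
independent. (If all weights are at most `W`, all layers outside `1, …, W` are empty.) -/
def unfold₂ (M : Matroid β) (w : β → ℕ) : Matroid (β × ℕ) :=
  Matroid.ofExistsMatroid (copies M.E w)
    (fun I ↦ I ⊆ copies M.E w ∧ ∀ i, M.Indep (layer₂ w I i)) (exists_unfold₂ M w)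

theorem unfold₁_indep_iff (M : Matroid β) (w : β → ℕ) (I : Set (β × ℕ)) :
    (unfold₁ M w).Indep I ↔ I ⊆ copies M.E w ∧ ∀ i, M.Indep (layer₁ I i) := Iff.rfl

theorem unfold₂_indep_iff (M : Matroid β) (w : β → ℕ) (I : Set (β × ℕ)) :
    (unfold₂ M w).Indep I ↔ I ⊆ copies M.E w ∧ ∀ i, M.Indep (layer₂ w I i) := Iff.rfl

/-- A (finite) common independent set of two matroids. -/
def IsCommonIndep {γ : Type*} (M₁ M₂ : Matroid γ) (I : Finset γ) : Prop :=
  M₁.Indep (I : Set γ) ∧ M₂.Indep (I : Set γ)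

/-- The maximum weight of a common independent set. -/
noncomputable def maxWeight {γ : Type*} (M₁ M₂ : Matroid γ) (w : γ → ℕ) : ℕ :=
  sSup {n | ∃ I : Finset γ, IsCommonIndep M₁ M₂ I ∧ n = ∑ e ∈ I, w e}

/-- The maximum cardinality of a common independent set. -/
noncomputable def maxCard {γ : Type*} (M₁ M₂ : Matroid γ) : ℕ :=
  sSup {n | ∃ I : Finset γ, IsCommonIndep M₁ M₂ I ∧ n = I.card}

/-- If the first ground set is finite, the maximum weight is attained. -/
theorem isGreatest_maxWeight {γ : Type*} (M₁ M₂ : Matroid γ) (w : γ → ℕ) (h : M₁.E.Finite) :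
    IsGreatest {n | ∃ I : Finset γ, IsCommonIndep M₁ M₂ I ∧ n = ∑ e ∈ I, w e}
      (maxWeight M₁ M₂ w) := by
  have hb : BddAbove {n | ∃ I : Finset γ, IsCommonIndep M₁ M₂ I ∧ n = ∑ e ∈ I, w e} := by
    refine ⟨∑ e ∈ h.toFinset, w e, ?_⟩
    rintro _ ⟨I, hI, rfl⟩
    exact Finset.sum_le_sum_of_subset fun e he ↦ h.mem_toFinset.2 (hI.1.subset_ground he)
  exact ⟨Nat.sSup_mem ⟨0, ∅, by simp [IsCommonIndep]⟩ hb, fun _ hn ↦ le_csSup hb hn⟩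

/-- If the first ground set is finite, the maximum cardinality is attained. -/
theorem isGreatest_maxCard {γ : Type*} (M₁ M₂ : Matroid γ) (h : M₁.E.Finite) :
    IsGreatest {n | ∃ I : Finset γ, IsCommonIndep M₁ M₂ I ∧ n = I.card} (maxCard M₁ M₂) := by
  simpa [maxWeight, maxCard] using isGreatest_maxWeight M₁ M₂ (fun _ ↦ 1) h

/-- The unfolded ground set of a finite set is finite. -/
theorem copies_finite {E : Set β} (hE : E.Finite) (w : β → ℕ) : (copies E w).Finite := by
  refine (hE.biUnion fun e _ ↦ ((Set.finite_Icc 1 (w e)).image (Prod.mk e))).subset ?_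
  rintro ⟨e, i⟩ ⟨h0, h1, h2⟩
  simp only [Set.mem_iUnion]
  exact ⟨e, h0, i, ⟨h1, h2⟩, rfl⟩

/-- `S` is an `a`-approximate maximum cardinality common independent set. -/
def IsApproxMaxCard {γ : Type*} (a : ℝ) (M₁ M₂ : Matroid γ) (S : Finset γ) : Prop :=
  IsCommonIndep M₁ M₂ S ∧ a * (maxCard M₁ M₂ : ℝ) ≤ (S.card : ℝ)

/-- The elements of `E` that have a copy in `S`. -/
def refoldGround (E : Set β) (w : β → ℕ) (S : Finset (β × ℕ)) : Set β :=
  {e | e ∈ E ∧ ∃ j, 1 ≤ j ∧ j ≤ w e ∧ (e, j) ∈ S}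

end MatroidUnfold

open Finset

namespace MatroidUnfold

/-! ### Submodular functions and integral separation -/

section Sandwich

variable {γ : Type*} [DecidableEq γ]

/-! All copies of a common independent set form a common independent set of the unfolded matroids,
so `opt'` is at most their maximum cardinality, and for `a ≥ 0` one gets `a * opt' ≤ |S|`. It
remains to find a common independent set of weight at least `|S|` inside the elements `E` met by
`S`. The bridge is weight splitting: every integral `p` gives `|S| ≤ levelRk M₁ E p + levelRk M₂ E
(w - p)` (`card_le_levelRk_add_levelRk`), and for a minimizing `p` some common independent `K ⊆ E`
weighs at least the right-hand side (`exists_isCommonIndep_levelRk_le`).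

To find `K`, note that `levelRk` has submodular increments in the directions `1_X` and `1_X - 1`;
the extra point `none` encodes the shift by `-1`. Minimality of `p` makes the increments of the two
summands compatible, so the discrete sandwich theorem provides an integral common subgradient `x`
(`exists_common_base`). It is 0/1-valued on `E`, and its support is `K`. -/

/-- `f` is submodular on the subsets of `s`. -/
def SubmodularOn (s : Finset γ) (f : Finset γ → ℤ) : Prop :=
  ∀ X ⊆ s, ∀ Y ⊆ s, f (X ∪ Y) + f (X ∩ Y) ≤ f X + f Y

/-- Minimizing a submodular function over the presence of one element, which costs `t`, yields a
submodular function. -/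
theorem SubmodularOn.min_insert {s : Finset γ} {v : γ} (hv : v ∉ s) {f : Finset γ → ℤ}
    (hf : SubmodularOn (insert v s) f) (t : ℤ) :
    SubmodularOn s fun X ↦ min (f X) (f (insert v X) - t) := by
  intro X hX Y hY
  have hX' := hX.trans (subset_insert v s)
  have hY' := hY.trans (subset_insert v s)
  have hXv := insert_subset_insert v hX
  have hYv := insert_subset_insert v hY
  have hvX : v ∉ X := fun h ↦ hv (hX h)
  have hvY : v ∉ Y := fun h ↦ hv (hY h)
  have h1 := hf _ hX' _ hY'
  have h2 := hf _ hXv _ hYv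
  have h3 := hf _ hX' _ hYv
  have h4 := hf _ hXv _ hY'
  rw [← insert_union_distrib, ← insert_inter_distrib] at h2
  rw [union_insert, inter_insert_of_notMem hvX] at h3
  rw [insert_union, insert_inter_of_notMem hvY] at h4
  simp only
  omega

/-- **Discrete sandwich theorem**: between an integral supermodular function `-g` and an integral
submodular function `f` above it there is an integral modular function. -/
theorem exists_modular_between (s : Finset γ) :
    ∀ f g : Finset γ → ℤ, SubmodularOn s f → SubmodularOn s g → f ∅ = 0 → g ∅ = 0 →
      (∀ X ⊆ s, 0 ≤ f X + g X) → ∃ x : γ → ℤ, ∀ X ⊆ s, -g X ≤ ∑ e ∈ X, x e ∧ ∑ e ∈ X, x e ≤ f X := by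
  induction s using Finset.induction_on with
  | empty =>
    intro f g _ _ hf0 hg0 _
    refine ⟨0, fun X hX ↦ ?_⟩
    rw [subset_empty.1 hX]
    simp [hf0, hg0]
  | insert v s hv ih =>
    intro f g hf hg hf0 hg0 hfg
    obtain ⟨Z, hZ, hmin⟩ := exists_min_image s.powerset (fun X ↦ f (insert v X) + g X)
      ⟨∅, empty_mem_powerset s⟩
    rw [mem_powerset] at hZ
    -- `t` becomes the value at `v`: the largest one for which the minima passed to the induction
    -- hypothesis stay compatible.
    set t := f (insert v Z) + g Z with ht
    have hup : ∀ X ⊆ s, t ≤ f (insert v X) + g X := fun X hX ↦ hmin X (mem_powerset.2 hX)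
    have hlow : ∀ X ⊆ s, -(g (insert v X) + f X) ≤ t := by
      intro X hX
      have hvX : v ∉ X := fun h ↦ hv (hX h)
      have hvZ : v ∉ Z := fun h ↦ hv (hZ h)
      -- Uncrossing `X` with `Z`: the two submodular inequalities produce `f + g` at `insert v (X ∪
      -- Z)` and at `X ∩ Z`, both nonnegative.
      have h1 := hf _ (hX.trans (subset_insert v s)) _ (insert_subset_insert v hZ)
      have h2 := hg _ (insert_subset_insert v hX) _ (hZ.trans (subset_insert v s))
      rw [union_insert, inter_insert_of_notMem hvX] at h1
      rw [insert_union, insert_inter_of_notMem hvZ] at h2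
      have h3 := hfg (insert v (X ∪ Z)) (insert_subset_insert v (union_subset hX hZ))
      have h4 := hfg (X ∩ Z) ((inter_subset_left.trans hX).trans (subset_insert v s))
      omega
    obtain ⟨x, hx⟩ := ih _ _ (hf.min_insert hv t) (hg.min_insert hv (-t))
      (by have := hup ∅ (empty_subset s); simp only [hf0, hg0] at this ⊢; omega)
      (by have := hlow ∅ (empty_subset s); simp only [hf0, hg0] at this ⊢; omega)
      (by
        intro X hX
        have h1 := hup X hX
        have h2 := hlow X hX
        have h3 := hfg X (hX.trans (subset_insert v s))
        have h4 := hfg _ (insert_subset_insert v hX)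
        omega)
    refine ⟨Function.update x v t, fun X hX ↦ ?_⟩
    have hsum : ∀ Y ⊆ s, ∑ e ∈ Y, Function.update x v t e = ∑ e ∈ Y, x e := fun Y hY ↦
      sum_congr rfl fun e he ↦ Function.update_of_ne (by rintro rfl; exact hv (hY he)) _ _
    by_cases hvX : v ∈ X
    · have hY : X.erase v ⊆ s := by rwa [← subset_insert_iff]
      have h := hx _ hY
      rw [← insert_erase hvX, sum_insert (notMem_erase v X), hsum _ hY, Function.update_self]
      omega
    · have hY : X ⊆ s := (subset_insert_iff_of_notMem hvX).1 hX
      have h := hx _ hY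
      rw [hsum _ hY]
      omega

theorem SubmodularOn.compl {s : Finset γ} {f : Finset γ → ℤ} (hf : SubmodularOn s f) :
    SubmodularOn s fun X ↦ f (s \ X) := by
  intro X _ Y _
  have := hf (s \ X) sdiff_subset (s \ Y) sdiff_subset
  rw [← sdiff_inter_distrib_right, ← sdiff_union_distrib] at this
  simp only
  omega

/-- Two integral base polyhedra whose submodular functions are compatible share an integral
point. -/
theorem exists_common_base {s : Finset γ} {f g : Finset γ → ℤ} (hf : SubmodularOn s f)
    (hg : SubmodularOn s g) (hf0 : f ∅ = 0) (hg0 : g ∅ = 0) (hfs : f s = 0) (hgs : g s = 0)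
    (hfg : ∀ X ⊆ s, 0 ≤ f X + g (s \ X)) :
    ∃ x : γ → ℤ, ∑ e ∈ s, x e = 0 ∧
      (∀ X ⊆ s, ∑ e ∈ X, x e ≤ f X) ∧ ∀ X ⊆ s, ∑ e ∈ X, x e ≤ g X := by
  obtain ⟨x, hx⟩ := exists_modular_between s f (fun X ↦ g (s \ X)) hf hg.compl hf0
    (by simpa using hgs) hfg
  have h0 : ∑ e ∈ s, x e = 0 := by
    have := hx s subset_rfl
    simp only [sdiff_self, hfs] at this
    simp only [bot_eq_empty, hg0] at this
    omega
  refine ⟨x, h0, fun X hX ↦ (hx X hX).2, fun X hX ↦ ?_⟩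
  have h1 := (hx (s \ X) sdiff_subset).1
  have h2 := sum_sdiff (f := x) hX
  rw [Finset.sdiff_sdiff_eq_self hX] at h1
  omega

end Sandwich

/-! ### Ranks of level sets and submodularity of their increments -/

section Rank

variable {β : Type*}

/-- The rank of a finite set in a matroid, as a natural number. -/
noncomputable def finRk (M : Matroid β) (X : Finset β) : ℕ := (M.eRk (X : Set β)).toNat

theorem coe_finRk (M : Matroid β) (X : Finset β) : (finRk M X : ℕ∞) = M.eRk (X : Set β) := by
  refine ENat.natCast_toNat (ne_top_of_le_ne_top ?_ (M.eRk_le_encard X))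
  simp

theorem finRk_empty (M : Matroid β) : finRk M ∅ = 0 := by simp [finRk]

theorem finRk_mono (M : Matroid β) {X Y : Finset β} (h : X ⊆ Y) : finRk M X ≤ finRk M Y := by
  have := M.eRk_mono (Finset.coe_subset.2 h)
  rw [← coe_finRk, ← coe_finRk] at this
  exact_mod_cast this

theorem finRk_le_card (M : Matroid β) (X : Finset β) : finRk M X ≤ #X := by
  have := M.eRk_le_encard (X : Set β)
  rw [← coe_finRk, Set.encard_coe_eq_coe_finsetCard] at this
  exact_mod_cast this

theorem finRk_submodular [DecidableEq β] (M : Matroid β) (X Y : Finset β) :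
    finRk M (X ∪ Y) + finRk M (X ∩ Y) ≤ finRk M X + finRk M Y := by
  have := M.eRk_inter_add_eRk_union_le (X : Set β) (Y : Set β)
  rw [← coe_inter, ← coe_union] at this
  simp only [← coe_finRk] at this
  rw [add_comm]
  exact_mod_cast this

theorem card_le_finRk {M : Matroid β} {I X : Finset β} (hI : M.Indep (I : Set β)) (h : I ⊆ X) :
    #I ≤ finRk M X := by
  have := hI.encard_le_eRk_of_subset (Finset.coe_subset.2 h)
  rw [← coe_finRk, Set.encard_coe_eq_coe_finsetCard] at this
  exact_mod_cast this

theorem indep_of_card_le_finRk {M : Matroid β} {I : Finset β} (h : #I ≤ finRk M I) :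
    M.Indep (I : Set β) := by
  rw [Matroid.indep_iff_eRk_eq_encard_of_finite I.finite_toSet, ← coe_finRk,
    Set.encard_coe_eq_coe_finsetCard, le_antisymm (finRk_le_card M I) h]

/-- The elements of `E` at which `q` is at least `i`. -/
def level (E : Finset β) (q : β → ℤ) (i : ℕ) : Finset β := {e ∈ E | (i : ℤ) ≤ q e}

@[simp]
theorem mem_level {E : Finset β} {q : β → ℤ} {i : ℕ} {e : β} :
    e ∈ level E q i ↔ e ∈ E ∧ (i : ℤ) ≤ q e := mem_filter

theorem level_eq_empty {E : Finset β} {q : β → ℤ} {i : ℕ} (h : ∀ e ∈ E, q e < i) :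
    level E q i = ∅ := filter_eq_empty_iff.2 fun e he ↦ not_le.2 (h e he)

/-- The sum of the ranks of all positive levels of `q`; this is the maximum `q`-weight of an
independent subset of `E`. -/
noncomputable def levelRk (M : Matroid β) (E : Finset β) (q : β → ℤ) : ℕ :=
  ∑ i ∈ Ico 1 (E.sup (fun e ↦ (q e).toNat) + 1), finRk M (level E q i)

theorem levelRk_eq (M : Matroid β) {E : Finset β} {q : β → ℤ} {n : ℕ} (h : ∀ e ∈ E, q e < n) :
    levelRk M E q = ∑ i ∈ Ico 1 n, finRk M (level E q i) := by
  have key : ∀ m k : ℕ, (∀ e ∈ E, q e < m) → m ≤ k →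
      ∑ i ∈ Ico 1 m, finRk M (level E q i) = ∑ i ∈ Ico 1 k, finRk M (level E q i) := by
    intro m k hm hmk
    refine sum_subset (Ico_subset_Ico_right hmk) fun i hi hi' ↦ ?_
    rw [mem_Ico] at hi hi'
    rw [level_eq_empty fun e he ↦ (hm e he).trans_le (by omega), finRk_empty]
  have h0 : ∀ e ∈ E, q e < (E.sup (fun e ↦ (q e).toNat) + 1 : ℕ) := by
    intro e he
    have := le_sup (f := fun e ↦ (q e).toNat) he
    omega
  rw [levelRk, key _ _ h0 (le_max_left _ n), ← key _ _ h (le_max_right _ n)]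

theorem exists_lt_natCast (E : Finset β) (q : β → ℤ) : ∃ n : ℕ, ∀ e ∈ E, q e < n := by
  refine ⟨E.sup (fun e ↦ (q e).toNat) + 1, fun e he ↦ ?_⟩
  have := le_sup (f := fun e ↦ (q e).toNat) he
  omega

theorem levelRk_mono (M : Matroid β) {E : Finset β} {q q' : β → ℤ} (h : ∀ e ∈ E, q e ≤ q' e) :
    levelRk M E q ≤ levelRk M E q' := by
  obtain ⟨n, hn⟩ := exists_lt_natCast E q'
  rw [levelRk_eq M hn, levelRk_eq M fun e he ↦ (h e he).trans_lt (hn e he)]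
  refine sum_le_sum fun i _ ↦ finRk_mono M fun e he ↦ ?_
  rw [mem_level] at he ⊢
  exact ⟨he.1, he.2.trans (h e he.1)⟩

theorem levelRk_congr (M : Matroid β) {E : Finset β} {q q' : β → ℤ} (h : ∀ e ∈ E, q e = q' e) :
    levelRk M E q = levelRk M E q' :=
  le_antisymm (levelRk_mono M fun e he ↦ (h e he).le) (levelRk_mono M fun e he ↦ (h e he).ge)

variable [DecidableEq β]

/-- The vector that is `1` on the elements of `X`, shifted down by `1` if `none ∈ X`. -/
def shift (X : Finset (Option β)) (e : β) : ℤ :=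
  (if some e ∈ X then 1 else 0) - if none ∈ X then 1 else 0

theorem shift_compl {E : Finset β} {X : Finset (Option β)} {e : β} (he : e ∈ E) :
    shift (insertNone E \ X) e = -shift X e := by
  simp only [shift, mem_sdiff, some_mem_insertNone, he, none_mem_insertNone, true_and]
  split_ifs <;> simp_all

/-- The change of `levelRk` at `p` in the direction of `X`. -/
noncomputable def levelRkDiff (M : Matroid β) (E : Finset β) (p : β → ℤ)
    (X : Finset (Option β)) : ℤ :=
  levelRk M E (p + shift X) - levelRk M E p

theorem levelRkDiff_empty (M : Matroid β) (E : Finset β) (p : β → ℤ) :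
    levelRkDiff M E p ∅ = 0 := by
  rw [levelRkDiff, levelRk_congr M (q' := p) (by simp [shift]), sub_self]

theorem levelRkDiff_insertNone (M : Matroid β) (E : Finset β) (p : β → ℤ) :
    levelRkDiff M E p (insertNone E) = 0 := by
  rw [levelRkDiff, levelRk_congr M (q' := p), sub_self]
  intro e he
  simp [shift, he]

/-- Subtracting 1 everywhere renumbers the levels of `p + 1_X`, so `none` only decides whether the
rank of its first level is counted. -/
theorem levelRk_add_shift (M : Matroid β) {E : Finset β} {p : β → ℤ} {n : ℕ}
    (hn : ∀ e ∈ E, p e < n) (X : Finset (Option β)) :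
    levelRk M E (p + shift X) =
      (if none ∈ X then 0 else finRk M (level E (fun e ↦ p e + if some e ∈ X then 1 else 0) 1)) +
      ∑ i ∈ Ico 1 (n + 1),
        finRk M (level E (fun e ↦ p e + if some e ∈ X then 1 else 0) (i + 1)) := by
  by_cases h : none ∈ X
  · rw [if_pos h, zero_add, levelRk_eq M (n := n + 1)]
    · refine sum_congr rfl fun i _ ↦ ?_
      congr 1
      ext e
      simp only [mem_level, Pi.add_apply, shift, if_pos h, Nat.cast_add, Nat.cast_one]
      refine and_congr_right fun _ ↦ ?_
      omega
    · intro e he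
      have := hn e he
      simp only [Pi.add_apply, shift, if_pos h, Nat.cast_add, Nat.cast_one]
      split_ifs <;> omega
  · rw [if_neg h, levelRk_eq M (n := n + 2), sum_eq_sum_Ico_succ_bot (by omega)]
    · rw [← sum_Ico_add' _ 1 (n + 1) 1]
      simp [shift, h, level]
    · intro e he
      have := hn e he
      simp only [Pi.add_apply, shift, if_neg h]
      push_cast
      split_ifs <;> omega

/-- Levels of `p + 1_X` turn unions and intersections of `X` into those of level sets, so rank
submodularity applies level by level. If exactly one of `X`, `Y` contains `none`, the first level
needs only monotonicity. -/
theorem submodularOn_levelRkDiff (M : Matroid β) (E : Finset β) (p : β → ℤ)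
    (s : Finset (Option β)) : SubmodularOn s (levelRkDiff M E p) := by
  obtain ⟨n, hn⟩ := exists_lt_natCast E p
  intro X _ Y _
  have hU : ∀ i, level E (fun e ↦ p e + if some e ∈ X ∪ Y then 1 else 0) i =
      level E (fun e ↦ p e + if some e ∈ X then 1 else 0) i ∪
        level E (fun e ↦ p e + if some e ∈ Y then 1 else 0) i := by
    intro i
    ext e
    simp only [mem_level, mem_union]
    split_ifs <;> simp_all <;> omega
  have hI : ∀ i, level E (fun e ↦ p e + if some e ∈ X ∩ Y then 1 else 0) i =
      level E (fun e ↦ p e + if some e ∈ X then 1 else 0) i ∩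
        level E (fun e ↦ p e + if some e ∈ Y then 1 else 0) i := by
    intro i
    ext e
    simp only [mem_level, mem_inter]
    split_ifs <;> simp_all <;> omega
  have hsum := sum_le_sum fun i (_ : i ∈ Ico 1 (n + 1)) ↦ finRk_submodular M
    (level E (fun e ↦ p e + if some e ∈ X then 1 else 0) (i + 1))
    (level E (fun e ↦ p e + if some e ∈ Y then 1 else 0) (i + 1))
  rw [sum_add_distrib, sum_add_distrib] at hsum
  have h1 := finRk_submodular M
    (level E (fun e ↦ p e + if some e ∈ X then 1 else 0) 1)
    (level E (fun e ↦ p e + if some e ∈ Y then 1 else 0) 1)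
  have h2 := finRk_mono M (inter_subset_left
    (s₁ := level E (fun e ↦ p e + if some e ∈ X then 1 else 0) 1)
    (s₂ := level E (fun e ↦ p e + if some e ∈ Y then 1 else 0) 1))
  have h3 := finRk_mono M (inter_subset_right
    (s₁ := level E (fun e ↦ p e + if some e ∈ X then 1 else 0) 1)
    (s₂ := level E (fun e ↦ p e + if some e ∈ Y then 1 else 0) 1))
  have key : levelRk M E (p + shift (X ∪ Y)) + levelRk M E (p + shift (X ∩ Y)) ≤
      levelRk M E (p + shift X) + levelRk M E (p + shift Y) := by
    simp only [levelRk_add_shift M hn, hU, hI]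
    by_cases hX : none ∈ X <;> by_cases hY : none ∈ Y <;>
      simp only [mem_union, mem_inter, hX, hY, or_self, and_self, or_true, or_false, and_true,
        and_false, if_true, if_false] <;> omega
  simp only [levelRkDiff]
  omega

/-- Level `i + 1` of `p + 1_X` is the old level `i + 1` together with the part of `X` in the old
level `i`. Submodularity then gives a telescoping sum of the ranks of `X ∩ level E p i`, starting
below the rank of `X`. -/
theorem levelRk_add_indicator_le (M : Matroid β) (E : Finset β) (p : β → ℤ) (X : Finset β) :
    levelRk M E (fun e ↦ p e + if e ∈ X then 1 else 0) ≤ levelRk M E p + finRk M X := by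
  have key : ∀ n : ℕ, ∑ i ∈ Ico 1 (n + 1), finRk M (level E (fun e ↦ p e + if e ∈ X then 1 else 0) i)
      + finRk M (X ∩ level E p n) ≤
      ∑ i ∈ Ico 1 (n + 1), finRk M (level E p i) + finRk M X := by
    intro n
    induction n with
    | zero => simpa using finRk_mono M (inter_subset_left (s₁ := X) (s₂ := level E p 0))
    | succ n ih =>
      rw [sum_Ico_succ_top (b := n + 1) (by omega),
        sum_Ico_succ_top (b := n + 1) (by omega) fun i ↦ finRk M (level E p i)]
      have hsub := finRk_submodular M (level E p (n + 1)) (X ∩ level E p n)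
      have hU : level E (fun e ↦ p e + if e ∈ X then 1 else 0) (n + 1) =
          level E p (n + 1) ∪ (X ∩ level E p n) := by
        ext e
        simp only [mem_level, mem_union, mem_inter]
        push_cast
        split_ifs <;> simp_all <;> omega
      have hI : level E p (n + 1) ∩ (X ∩ level E p n) = X ∩ level E p (n + 1) := by
        ext e
        simp only [mem_level, mem_inter]
        push_cast
        refine ⟨fun h ↦ ⟨h.2.1, h.1⟩, fun h ↦ ⟨h.2, h.1, h.2.1, by omega⟩⟩
      rw [hI, ← hU] at hsub
      omega
  obtain ⟨n, hn⟩ := exists_lt_natCast E p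
  have h := key n
  rw [levelRk_eq M (n := n + 1), levelRk_eq M (n := n + 1) (q := p)]
  · omega
  · intro e he
    have := hn e he
    push_cast
    omega
  · intro e he
    have := hn e he
    push_cast
    split_ifs <;> omega

/-- Levels below `k` are unchanged and those above move down by one, so exactly the `k`-th term
disappears. -/
theorem levelRk_sub_level (M : Matroid β) (E : Finset β) (p : β → ℤ) {k : ℕ} (hk : 1 ≤ k) :
    levelRk M E (fun e ↦ p e - if e ∈ level E p k then 1 else 0) + finRk M (level E p k) =
      levelRk M E p := by
  have key : ∀ n, k ≤ n →
      ∑ i ∈ Ico 1 n, finRk M (level E (fun e ↦ p e - if e ∈ level E p k then 1 else 0) i) +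
        finRk M (level E p k) =
      ∑ i ∈ Ico 1 (n + 1), finRk M (level E p i) := by
    intro n hkn
    induction n, hkn using Nat.le_induction with
    | base =>
      rw [sum_Ico_succ_top hk]
      congr 1
      refine sum_congr rfl fun i hi ↦ ?_
      rw [mem_Ico] at hi
      congr 1
      ext e
      simp only [mem_level]
      refine and_congr_right fun he ↦ ?_
      simp only [he, true_and]
      split_ifs <;> omega
    | succ n hkn ih =>
      rw [sum_Ico_succ_top (hk.trans hkn), sum_Ico_succ_top (b := n + 1) (by omega), ← ih]
      have : level E (fun e ↦ p e - if e ∈ level E p k then 1 else 0) n = level E p (n + 1) := by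
        ext e
        simp only [mem_level]
        refine and_congr_right fun he ↦ ?_
        simp only [he, true_and]
        push_cast
        split_ifs <;> omega
      rw [this]
      omega
  obtain ⟨n, hn⟩ := exists_lt_natCast E p
  rw [levelRk_eq M (n := n + k), key _ (by omega), levelRk_eq M (n := n + k + 1)]
  · intro e he
    have := hn e he
    push_cast
    omega
  · intro e he
    have := hn e he
    push_cast
    split_ifs <;> omega

end Rank

/-! ### Integral subgradients of the level rank sum -/

section Subgradient

variable {β : Type*} [DecidableEq β] {M : Matroid β} {E : Finset β} {p : β → ℤ} {x : Option β → ℤ}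

theorem sum_le_finRk (hx : ∀ X ⊆ insertNone E, ∑ e ∈ X, x e ≤ levelRkDiff M E p X)
    {X : Finset β} (hX : X ⊆ E) : ∑ e ∈ X, x (some e) ≤ finRk M X := by
  have h1 := hx (X.map Function.Embedding.some) (by
    intro e he
    obtain ⟨f, hf, rfl⟩ := mem_map.1 he
    simpa using hX hf)
  have h2 := levelRk_add_indicator_le M E p X
  rw [sum_map] at h1
  have h3 : levelRk M E (p + shift (X.map Function.Embedding.some)) =
      levelRk M E (fun e ↦ p e + if e ∈ X then 1 else 0) :=
    levelRk_congr M fun e _ ↦ by simp [shift]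
  rw [levelRkDiff, h3] at h1
  simp only [Function.Embedding.some_apply] at h1
  omega

/-- Raising a negative entry by 1 leaves all positive levels unchanged. -/
theorem subgradient_nonpos_of_neg (hx : ∀ X ⊆ insertNone E, ∑ e ∈ X, x e ≤ levelRkDiff M E p X)
    {e : β} (he : e ∈ E) (hp : p e < 0) : x (some e) ≤ 0 := by
  have h1 := hx {some e} (by simpa using he)
  obtain ⟨n, hn⟩ := exists_lt_natCast E p
  have h2 : levelRk M E (p + shift {some e}) = levelRk M E p := by
    have hs : ∀ f, (p + shift {some e}) f = if f = e then p e + 1 else p f := by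
      intro f
      by_cases hf : f = e
      · simp [shift, hf]
      · simp [shift, hf]
    rw [levelRk_eq M (n := n + 1), levelRk_eq M (n := n + 1)]
    · refine sum_congr rfl fun i hi ↦ ?_
      rw [mem_Ico] at hi
      congr 1
      ext f
      simp only [mem_level, hs]
      refine and_congr_right fun _ ↦ ?_
      split_ifs with hf
      · subst hf
        omega
      · rfl
    · intro f hf
      have := hn f hf
      push_cast
      omega
    · intro f hf
      have := hn f hf
      rw [hs]
      push_cast
      split_ifs <;> omega
  rw [levelRkDiff, h2, sum_singleton] at h1
  omega

/-- Since `x` has total 0, its upper bound on the complement of `X`, whose shift is the negative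
one, is a lower bound on `X`. -/
theorem levelRk_sub_le_sum (hx0 : ∑ e ∈ insertNone E, x e = 0)
    (hx : ∀ X ⊆ insertNone E, ∑ e ∈ X, x e ≤ levelRkDiff M E p X) {X : Finset β} (hX : X ⊆ E) :
    (levelRk M E p : ℤ) ≤
      levelRk M E (fun e ↦ p e - if e ∈ X then 1 else 0) + ∑ e ∈ X, x (some e) := by
  have hsub : X.map Function.Embedding.some ⊆ insertNone E := by
    intro e he
    obtain ⟨f, hf, rfl⟩ := mem_map.1 he
    simpa using hX hf
  have h1 := hx (insertNone E \ X.map Function.Embedding.some) sdiff_subset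
  have h2 := sum_sdiff (f := x) hsub
  have h3 : levelRk M E (p + shift (insertNone E \ X.map Function.Embedding.some)) =
      levelRk M E (fun e ↦ p e - if e ∈ X then 1 else 0) := by
    refine levelRk_congr M fun e he ↦ ?_
    rw [Pi.add_apply, shift_compl he]
    simp [shift, sub_eq_add_neg]
  rw [sum_map] at h2
  rw [levelRkDiff, h3] at h1
  simp only [Function.Embedding.some_apply] at h2
  omega

theorem subgradient_nonneg (hx0 : ∑ e ∈ insertNone E, x e = 0)
    (hx : ∀ X ⊆ insertNone E, ∑ e ∈ X, x e ≤ levelRkDiff M E p X) {e : β} (he : e ∈ E) :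
    0 ≤ x (some e) := by
  have h1 := levelRk_sub_le_sum hx0 hx (singleton_subset_iff.2 he)
  have h2 : levelRk M E (fun f ↦ p f - if f ∈ ({e} : Finset β) then 1 else 0) ≤ levelRk M E p :=
    levelRk_mono M fun f _ ↦ by split_ifs <;> omega
  rw [sum_singleton] at h1
  omega

/-- Lowering `p` on its `i`-th level costs exactly the rank of that level, which is therefore at
most the sum of `x` over it. Summed over `i ≥ 1`, each `e` is counted `max (p e) 0` times. -/
theorem levelRk_le_sum_mul (hx0 : ∑ e ∈ insertNone E, x e = 0)
    (hx : ∀ X ⊆ insertNone E, ∑ e ∈ X, x e ≤ levelRkDiff M E p X) :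
    (levelRk M E p : ℤ) ≤ ∑ e ∈ E, x (some e) * max (p e) 0 := by
  obtain ⟨n, hn⟩ := exists_lt_natCast E p
  have h1 : ∀ i ∈ Ico 1 n, (finRk M (level E p i) : ℤ) ≤
      ∑ e ∈ E, if (i : ℤ) ≤ p e then x (some e) else 0 := by
    intro i hi
    have h1 := levelRk_sub_le_sum hx0 hx (X := level E p i) (filter_subset _ _)
    have h2 := levelRk_sub_level M E p (mem_Ico.1 hi).1
    have h3 : ∑ e ∈ level E p i, x (some e) = ∑ e ∈ E, if (i : ℤ) ≤ p e then x (some e) else 0 :=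
      sum_filter _ _
    omega
  rw [levelRk_eq M hn, Nat.cast_sum]
  refine (sum_le_sum h1).trans (le_of_eq ?_)
  rw [sum_comm]
  refine sum_congr rfl fun e he ↦ ?_
  have hc : (Ico 1 n).filter (fun i : ℕ ↦ (i : ℤ) ≤ p e) = Ico 1 ((p e).toNat + 1) := by
    ext i
    have := hn e he
    simp only [mem_filter, mem_Ico]
    omega
  rw [← sum_filter, hc, sum_const, Nat.card_Ico, nsmul_eq_mul, mul_comm]
  congr 1
  simp

end Subgradient

/-! ### Weight splitting and its link to unfolding -/

section WeightSplitting

variable {β : Type*}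

/-- **Weight splitting** for weighted matroid intersection: some common independent subset of `E`
weighs at least as much as the bound given by a splitting `w = p + (w - p)`. -/
theorem exists_isCommonIndep_levelRk_le (M₁ M₂ : Matroid β) (E : Finset β) (w : β → ℕ) :
    ∃ (p : β → ℤ) (K : Finset β), K ⊆ E ∧ IsCommonIndep M₁ M₂ K ∧
      levelRk M₁ E p + levelRk M₂ E (fun e ↦ w e - p e) ≤ ∑ e ∈ K, w e := by
  classical
  -- The infimum over infinitely many `p` is attained because the values are natural numbers.
  obtain ⟨p, hp⟩ : ∃ p : β → ℤ, ∀ q : β → ℤ,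
      levelRk M₁ E p + levelRk M₂ E (fun e ↦ w e - p e) ≤
        levelRk M₁ E q + levelRk M₂ E (fun e ↦ w e - q e) :=
    ⟨Function.argmin (fun q : β → ℤ ↦ levelRk M₁ E q + levelRk M₂ E (fun e ↦ w e - q e)),
      fun q ↦ Function.argmin_le
        (fun q : β → ℤ ↦ levelRk M₁ E q + levelRk M₂ E (fun e ↦ w e - q e)) q⟩
  obtain ⟨x, hx0, hx1, hx2⟩ := exists_common_base (submodularOn_levelRkDiff M₁ E p (insertNone E))
    (submodularOn_levelRkDiff M₂ E (fun e ↦ w e - p e) (insertNone E))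
    (levelRkDiff_empty _ _ _) (levelRkDiff_empty _ _ _)
    (levelRkDiff_insertNone _ _ _) (levelRkDiff_insertNone _ _ _) (by
      intro X _
      have h1 := hp (p + shift X)
      have h2 : levelRk M₂ E ((fun e ↦ w e - p e) + shift (insertNone E \ X)) =
          levelRk M₂ E (fun e ↦ w e - (p + shift X) e) := by
        refine levelRk_congr M₂ fun e he ↦ ?_
        rw [Pi.add_apply, shift_compl he, Pi.add_apply]
        ring
      simp only [levelRkDiff, h2]
      omega)
  have h01 : ∀ e ∈ E, x (some e) = 0 ∨ x (some e) = 1 := by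
    intro e he
    have h1 := subgradient_nonneg hx0 hx1 he
    have h2 := sum_le_finRk hx1 (singleton_subset_iff.2 he)
    have h3 := finRk_le_card M₁ {e}
    rw [sum_singleton] at h2
    rw [card_singleton] at h3
    omega
  have hK : {e ∈ E | x (some e) = 1} ⊆ E := filter_subset _ E
  have hcard : ∑ e ∈ E with x (some e) = 1, x (some e) = #{e ∈ E | x (some e) = 1} := by
    rw [sum_congr rfl fun e he ↦ (mem_filter.1 he).2]
    simp
  refine ⟨p, {e ∈ E | x (some e) = 1}, hK, ⟨?_, ?_⟩, ?_⟩
  · have := sum_le_finRk hx1 hK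
    -- The sum of `x` over its support is the cardinality, so the rank bound forces independence.
    exact indep_of_card_le_finRk (by omega)
  · have := sum_le_finRk hx2 hK
    exact indep_of_card_le_finRk (by omega)
  · have h1 := levelRk_le_sum_mul hx0 hx1
    have h2 := levelRk_le_sum_mul hx0 hx2
    have h3 : ∑ e ∈ E, x (some e) * max (p e) 0 + ∑ e ∈ E, x (some e) * max (w e - p e) 0 =
        ∑ e ∈ E with x (some e) = 1, (w e : ℤ) := by
      rw [← sum_add_distrib, sum_filter]
      refine sum_congr rfl fun e he ↦ ?_
      rcases h01 e he with h | h
      · simp [h]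
      -- On the support neither part of the splitting is negative, so the truncated parts add up to
      -- `w e`.
      · have hp1 : 0 ≤ p e := by
          by_contra! hlt
          have := subgradient_nonpos_of_neg hx1 he hlt
          omega
        have hp2 : 0 ≤ w e - p e := by
          by_contra! hlt
          have := subgradient_nonpos_of_neg hx2 he hlt
          omega
        rw [h, if_pos rfl, max_eq_left hp1, max_eq_left hp2]
        ring
    zify
    omega

/-- Any splitting of the weights bounds the cardinality of the common independent sets of the
unfolded matroids. -/
theorem card_le_levelRk_add_levelRk {M₁ M₂ : Matroid β} {w : β → ℕ} {S : Finset (β × ℕ)}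
    (hS : IsCommonIndep (unfold₁ M₁ w) (unfold₂ M₂ w) S) {E : Finset β}
    (hE : ∀ s ∈ S, s.1 ∈ E) (p : β → ℤ) :
    #S ≤ levelRk M₁ E p + levelRk M₂ E (fun e ↦ w e - p e) := by
  classical
  obtain ⟨h1, h2⟩ := hS
  rw [unfold₁_indep_iff] at h1
  rw [unfold₂_indep_iff] at h2
  have hcop : ∀ s ∈ S, 1 ≤ s.2 ∧ s.2 ≤ w s.1 := fun s hs ↦ (h1.1 hs).2
  obtain ⟨n, hn⟩ := exists_lt_natCast E p
  obtain ⟨m, hm⟩ := exists_lt_natCast E fun e ↦ w e - p e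
  -- A copy `(e, j)` with `j ≤ p e` is charged to layer `j` of `M₁`; otherwise `w e + 1 - j ≤ w e -
  -- p e`, and it is charged to that layer of `M₂`.
  rw [← card_filter_add_card_filter_not (s := S) (fun s ↦ (s.2 : ℤ) ≤ p s.1)]
  refine add_le_add ?_ ?_
  · rw [levelRk_eq M₁ hn, card_eq_sum_card_fiberwise (f := Prod.snd) (t := Ico 1 n)]
    · refine sum_le_sum fun i _ ↦ ?_
      rw [← card_image_of_injOn (f := Prod.fst)]
      · refine card_le_finRk ((h1.2 i).subset ?_) ?_
        · intro e he
          simp only [coe_image, coe_filter, mem_filter, Set.mem_image, Set.mem_ofPred_eq] at he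
          obtain ⟨⟨f, j⟩, ⟨⟨hs, -⟩, rfl⟩, rfl⟩ := he
          exact hs
        · intro e he
          simp only [mem_image, mem_filter] at he
          obtain ⟨⟨f, j⟩, ⟨⟨hs, hle⟩, rfl⟩, rfl⟩ := he
          exact mem_level.2 ⟨hE _ hs, hle⟩
      · rintro ⟨e, j⟩ hs ⟨f, k⟩ ht h
        simp only [coe_filter, mem_filter, Set.mem_ofPred_eq] at hs ht h
        rw [h, hs.2, ht.2]
    · intro s hs
      simp only [coe_filter, Set.mem_ofPred_eq] at hs
      have := hn _ (hE _ hs.1)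
      have := hcop _ hs.1
      simp only [coe_Ico, Set.mem_Ico]
      omega
  · rw [levelRk_eq M₂ hm, card_eq_sum_card_fiberwise (f := fun s ↦ w s.1 + 1 - s.2) (t := Ico 1 m)]
    · refine sum_le_sum fun i _ ↦ ?_
      rw [← card_image_of_injOn (f := Prod.fst)]
      · refine card_le_finRk ((h2.2 i).subset ?_) ?_
        · intro e he
          simp only [coe_image, coe_filter, mem_filter, Set.mem_image, Set.mem_ofPred_eq] at he
          obtain ⟨⟨f, j⟩, ⟨⟨hs, -⟩, rfl⟩, rfl⟩ := he
          have := hcop _ hs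
          change (f, w f + 1 - (w f + 1 - j)) ∈ S
          simp only at this
          rwa [show w f + 1 - (w f + 1 - j) = j by omega]
        · intro e he
          simp only [mem_image, mem_filter] at he
          obtain ⟨⟨f, j⟩, ⟨⟨hs, hle⟩, rfl⟩, rfl⟩ := he
          have := hcop _ hs
          refine mem_level.2 ⟨hE _ hs, ?_⟩
          simp only at this hle ⊢
          omega
      · rintro ⟨e, j⟩ hs ⟨f, k⟩ ht h
        simp only [coe_filter, mem_filter, Set.mem_ofPred_eq] at hs ht h
        subst h
        have := hcop _ hs.1.1
        have := hcop _ ht.1.1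
        simp only at *
        rw [show j = k by omega]
    · intro s hs
      simp only [coe_filter, Set.mem_ofPred_eq] at hs
      have := hm _ (hE _ hs.1)
      have := hcop _ hs.1
      simp only [coe_Ico, Set.mem_Ico]
      omega

/-- Taking all copies of the elements of a common independent set yields a common independent set
of the unfolded matroids. -/
theorem maxWeight_le_maxCard_unfold (M₁ M₂ : Matroid β) [M₁.Finite] (w : β → ℕ) :
    maxWeight M₁ M₂ w ≤ maxCard (unfold₁ M₁ w) (unfold₂ M₂ w) := by
  obtain ⟨I, hI, hw⟩ := (isGreatest_maxWeight M₁ M₂ w M₁.ground_finite).1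
  rw [hw]
  refine (isGreatest_maxCard (unfold₁ M₁ w) (unfold₂ M₂ w)
    (copies_finite M₁.ground_finite w)).2
    ⟨(I.sigma fun e ↦ Icc 1 (w e)).map (Equiv.sigmaEquivProd β ℕ).toEmbedding, ⟨?_, ?_⟩, by simp⟩
  · rw [unfold₁_indep_iff]
    refine ⟨?_, fun i ↦ hI.1.subset ?_⟩
    · rintro ⟨e, i⟩ h
      simp at h
      exact ⟨hI.1.subset_ground h.1, h.2⟩
    · intro e h
      simp [layer₁] at h
      exact h.1
  · rw [unfold₂_indep_iff]
    refine ⟨?_, fun i ↦ hI.2.subset ?_⟩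
    · rintro ⟨e, i⟩ h
      simp at h
      exact ⟨hI.2.subset_ground h.1, h.2⟩
    · intro e h
      simp [layer₂] at h
      exact h.1

end WeightSplitting

end MatroidUnfold

/-! ### The approximation ratio after refolding -/

/-- Refolding keeps the approximation ratio: the maximum weight of a common independent set of the
refolded matroids is at least `a` times that of the original weighted matroids. -/
theorem mainTheorem6 {β : Type*} (M₁ M₂ : Matroid β) [M₁.Finite] (hE : M₂.E = M₁.E)
    (w : β → ℕ) (hw : ∀ e ∈ M₁.E, 1 ≤ w e) (a : ℝ) (S : Finset (β × ℕ))
    (hS : MatroidUnfold.IsApproxMaxCard a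
      (MatroidUnfold.unfold₁ M₁ w) (MatroidUnfold.unfold₂ M₂ w) S) :
    a * (MatroidUnfold.maxWeight M₁ M₂ w : ℝ) ≤
      (MatroidUnfold.maxWeight
        (M₁.restrict (MatroidUnfold.refoldGround M₁.E w S))
        (M₂.restrict (MatroidUnfold.refoldGround M₂.E w S)) w : ℝ) := by
  obtain ⟨hS, hcard⟩ := hS
  -- Multiplying `opt' ≤ maxCard` by `a` needs `a ≥ 0`; for negative `a` the claim is a comparison
  -- of signs.
  rcases lt_or_ge a 0 with ha | ha
  · exact (mul_nonpos_of_nonpos_of_nonneg ha.le (Nat.cast_nonneg _)).trans (Nat.cast_nonneg _)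
  have hfin : (MatroidUnfold.refoldGround M₁.E w S).Finite :=
    M₁.ground_finite.subset fun e he ↦ he.1
  obtain ⟨p, K, hK, hind, hle⟩ :=
    MatroidUnfold.exists_isCommonIndep_levelRk_le M₁ M₂ hfin.toFinset w
  have hSle := MatroidUnfold.card_le_levelRk_add_levelRk hS (E := hfin.toFinset) (by
    rintro ⟨e, i⟩ hs
    obtain ⟨h0, h1, h2⟩ := hS.1.1 hs
    exact hfin.mem_toFinset.2 ⟨h0, i, h1, h2, hs⟩) p
  have hK' : (K : Set β) ⊆ MatroidUnfold.refoldGround M₁.E w S := fun e he ↦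
    hfin.mem_toFinset.1 (hK he)
  have hmax := (MatroidUnfold.isGreatest_maxWeight
    (M₁.restrict (MatroidUnfold.refoldGround M₁.E w S))
    (M₂.restrict (MatroidUnfold.refoldGround M₂.E w S)) w hfin).2
    ⟨K, ⟨Matroid.restrict_indep_iff.2 ⟨hind.1, hK'⟩,
      Matroid.restrict_indep_iff.2 ⟨hind.2, hE ▸ hK'⟩⟩, rfl⟩
  have hopt := MatroidUnfold.maxWeight_le_maxCard_unfold M₁ M₂ w
  calc a * (MatroidUnfold.maxWeight M₁ M₂ w : ℝ)
      ≤ a * (MatroidUnfold.maxCard (MatroidUnfold.unfold₁ M₁ w) (MatroidUnfold.unfold₂ M₂ w) : ℝ) :=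
        mul_le_mul_of_nonneg_left (Nat.cast_le.2 hopt) ha
    _ ≤ (S.card : ℝ) := hcard
    _ ≤ _ := Nat.cast_le.2 ((hSle.trans hle).trans hmax)
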